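/- For an abelian group $G$ and a pair $w=(\lambda_1,\lambda_2)$ of integers, or $w=(\tfrac12,\tfrac12)$ if $G$ has odd order (where $\tfrac12 g$ is the unique $x\in G$ with $x+x=g$), a set $A\subseteq G$ is called $w$-saturating if every $x\in G\setminus A$ can be written as $x=\lambda_1a'+\lambda_2a''$ with distinct $a',a''\in A$, and $w$-avoiding if $a=\lambda_1a'+\lambda_2a''$ has no solution with pairwise distinct $a,a',a''\in A$; it is complete $w$-avoiding if it is both $w$-avoiding and $w$-saturating. Let $\mathrm{sat}(w,G)$ be the minimum size of a $w$-saturating set of $G$, and $a(w,G)$ the minimum size of a complete $w$-avoiding set of $G$ (with $a(w,G)=\infty$ if there is none). Let $\mathbb{Z}_m$ be the cyclic group of order $m$. Theorem. Let $m$ denote a positive odd integer. Then (1) $\mathrm{sat}((2,-1),\mathbb{Z}_m)<\sqrt{c_m\cdot m}$, where $c_m\in[1,3]$ is a constant depending only on $m$. (2) $a((2,-1),\mathbb{Z}_m)<\sqrt{c_m\cdot m}$, where $c_m\in[1,1.5]$ is a constant depending only on $m$, provided that $\frac23(4^n-1)<m<4^n$ holds for some positive integer $n$. (3) $\sqrt{2m}-0.5<\mathrm{sat}((\tfrac12,\tfrac12),\mathbb{Z}_m)\le(\sqrt{3.5}+o(1))\sqrt{m}$,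 where the lower bound holds for every $m$ and the $o(1)$ term tends to $0$ as $m\to\infty$. (4) $a((2,-1),\mathbb{Z}_m)=\lceil\sqrt{m}\rceil$, provided that $m=2^{2t}+2^t+1$ for some positive integer $t$. -/

import Mathlib

open Filter Topology

section Saturation

variable {G : Type*} [AddCommGroup G]

/-- `A` is `W`-avoiding, for a set `W` of integer coefficient vectors: no `(l₁, l₂) ∈ W` admits
pairwise distinct `a, a', a'' ∈ A` with `a = l₁ a' + l₂ a''`. -/
def IsAvoiding (W : Set (ℤ × ℤ)) (A : Set G) : Prop :=
  ¬ ∃ w ∈ W, ∃ a ∈ A, ∃ a' ∈ A, ∃ a'' ∈ A,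
    a ≠ a' ∧ a ≠ a'' ∧ a' ≠ a'' ∧ a = w.1 • a' + w.2 • a''

/-- `A` is `W`-saturating: every `x ∉ A` is `l₁ a' + l₂ a''` for some `(l₁, l₂) ∈ W` and some
distinct `a', a'' ∈ A`. -/
def IsSaturating (W : Set (ℤ × ℤ)) (A : Set G) : Prop :=
  ∀ x ∉ A, ∃ w ∈ W, ∃ a' ∈ A, ∃ a'' ∈ A, a' ≠ a'' ∧ x = w.1 • a' + w.2 • a''

/-- `A` is complete `W`-avoiding: it is both `W`-avoiding and `W`-saturating. -/
def IsCompleteAvoiding (W : Set (ℤ × ℤ)) (A : Set G) : Prop :=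
  IsAvoiding W A ∧ IsSaturating W A

/-- `(1/2) g` in a group of odd order: it is `(k + 1) g`, where `2k + 1` is the order of `g`. -/
noncomputable def half (g : G) : G := ((addOrderOf g + 1) / 2) • g

/-- In a group of odd order, `half g` is the unique `x` with `x + x = g`. -/
theorem add_self_eq_iff_eq_half (hG : Odd (Nat.card G)) (x g : G) :
    x + x = g ↔ x = half g := by
  have key : ∀ y : G, half y + half y = y := by
    intro y
    obtain ⟨k, hk⟩ : Odd (addOrderOf y) := hG.of_dvd_nat (addOrderOf_dvd_natCard y)
    have h2 : (addOrderOf y + 1) / 2 + (addOrderOf y + 1) / 2 = addOrderOf y + 1 := by omega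
    rw [half, ← add_nsmul, h2, add_nsmul, addOrderOf_nsmul_eq_zero, zero_add, one_nsmul]
  have tor : ∀ y : G, y + y = 0 → y = 0 := by
    intro y hy
    have h1 : addOrderOf y ∣ 2 := addOrderOf_dvd_of_nsmul_eq_zero (by rw [two_nsmul, hy])
    have h2 : Odd (addOrderOf y) := hG.of_dvd_nat (addOrderOf_dvd_natCard y)
    rcases (Nat.dvd_prime Nat.prime_two).1 h1 with h | h
    · exact AddMonoid.addOrderOf_eq_one_iff.1 h
    · rw [h] at h2
      exact absurd h2 (by decide)
  constructor
  · intro h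
    refine sub_eq_zero.1 (tor _ ?_)
    have : x - half g + (x - half g) = (x + x) - (half g + half g) := by abel
    rw [this, key, h, sub_self]
  · rintro rfl
    exact key g

/-- `A` is `(1/2, 1/2)`-saturating (meant for groups of odd order). -/
def IsHalfSaturating (A : Set G) : Prop :=
  ∀ x ∉ A, ∃ a' ∈ A, ∃ a'' ∈ A, a' ≠ a'' ∧ x = half a' + half a''

end Saturation

/-- `sat(W, G)`: the minimum size of a `W`-saturating set of `G`. -/
noncomputable def sat (W : Set (ℤ × ℤ)) (G : Type*) [AddCommGroup G] : ℕ∞ :=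
  ⨅ (A : Set G) (_ : IsSaturating W A), A.encard

/-- `sat((1/2, 1/2), G)`: the minimum size of a `(1/2, 1/2)`-saturating set of `G`. -/
noncomputable def satHalf (G : Type*) [AddCommGroup G] : ℕ∞ :=
  ⨅ (A : Set G) (_ : IsHalfSaturating A), A.encard

/-- `a(W, G)`: the minimum size of a complete `W`-avoiding set of `G`; it is `∞` if there is no
such set. -/
noncomputable def minComplete (W : Set (ℤ × ℤ)) (G : Type*) [AddCommGroup G] : ℕ∞ :=
  ⨅ (A : Set G) (_ : IsCompleteAvoiding W A), A.encard

/-!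
All four bounds come from explicit sets, together with the counting bounds `m ≤ s²` for
`(2, -1)`-saturating sets and `2m ≤ (s + 1)s` for `(1/2, 1/2)`-saturating sets of size `s`.

*Coefficients `(2, -1)`, general `m`.* Let `D` be the set of integers with `n` base-`4` digits, all
`0` or `1`. Since `2e - f` takes the values `-1, 0, 1, 2` for digits `e, f`, the numbers `2a - b`
with `a, b ∈ D` form an interval of `4 ^ n` integers (`CoversInterval.appendDigit_iterate`). Hence
the `2 ^ n` elements of `D` are saturating modulo every `m ≤ 4 ^ n`; no condition `a ≠ b` is lost,
as `2a - a = a`. Moreover `a + b = 2c` has only trivial solutions in `D`, and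
`D ⊆ [0, (4 ^ n - 1) / 3]`, so there are none modulo `m` either once `m > 2 (4 ^ n - 1) / 3`
(`isAvoiding_residues`). When `m` is only slightly above a power of `4`, the loss in rounding up to
the next one is too large; allowing `0, 1, 2` as leading digit then gives `3 * 2 ^ k` elements that
cover `7 * 4 ^ k` integers.

*Coefficients `(1/2, 1/2)`.* Doubling is bijective, so a set is saturating exactly if it is an
additive basis of order two of `ZMod m`. Mrose's basis, a union of five arithmetic progressions with
`7t + 3` elements in all, reaches every integer in `[0, 14t² + 10t)`
(`exists_add_eq_of_mroseBasis`), and `49 / 14 = 3.5`.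

*The case `m = q² + q + 1` with `q = 2 ^ t`.* In the cyclic group `Fˣ / Kˣ` of order `m`, where
`F / K` is the cubic extension of the field with `q` elements, the trace-zero elements form a Singer
difference set `D`: any two distinct translates meet in exactly one point, because the planes
`ker Tr` and `u⁻¹ ker Tr` of `F` meet in a line (`exists_mem_ker_mul_mem_ker`,
`exists_smul_eq_of_mem_ker`). So `D` is a Sidon set with `q + 1` elements whose differences are all
nonzero elements. In characteristic two `Tr (x²) = (Tr x)²`, so `D` is fixed by doubling, and `2a`
can replace `a` in these differences; a Sidon set has no three-term progressions
(`isCompleteAvoiding_of_sidon`).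
-/

/-! ### Minimum sizes and counting bounds -/

/-- A minimum size over a family of sets with a member of at most `N` elements is a natural number,
is at most `N`, and is attained. -/
theorem exists_iInf_encard_eq_natCast {G : Type*} {P : Set G → Prop} {A : Set G} (hA : P A) {N : ℕ}
    (h : A.encard ≤ N) :
    ∃ s : ℕ, (⨅ (A : Set G) (_ : P A), A.encard) = s ∧ s ≤ N ∧ ∃ B, P B ∧ B.encard = s := by
  have : Nonempty {A : Set G // P A} := ⟨⟨A, hA⟩⟩
  obtain ⟨⟨B, hB⟩, hB'⟩ := ciInf_mem fun A : {A : Set G // P A} ↦ A.1.encard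
  have hB'' : B.encard = ⨅ (A : Set G) (_ : P A), A.encard := hB'.trans iInf_subtype
  rw [← hB'']
  obtain ⟨s, hs, hsN⟩ := ENat.le_natCast_iff.1 (hB''.trans_le ((iInf₂_le A hA).trans h))
  exact ⟨s, hs, hsN, B, hB, hs⟩

theorem IsSaturating.natCast_le_sq {m : ℕ} [NeZero m] {A : Finset (ZMod m)}
    (hA : IsSaturating {(2, -1)} (A : Set (ZMod m))) : m ≤ A.card ^ 2 := by
  have hsub : (Finset.univ : Finset (ZMod m)) ⊆
      (A ×ˢ A).image fun p ↦ (2 : ℤ) • p.1 + (-1 : ℤ) • p.2 := by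
    intro x _
    rw [Finset.mem_image]
    by_cases hx : x ∈ A
    · exact ⟨(x, x), by simp [hx], by module⟩
    · obtain ⟨w, rfl, a, ha, b, hb, -, rfl⟩ := hA x (by simpa using hx)
      exact ⟨(a, b), by simpa using ⟨ha, hb⟩, rfl⟩
  have h := (Finset.card_le_card hsub).trans Finset.card_image_le
  rwa [Finset.card_univ, ZMod.card, Finset.card_product, ← sq] at h

theorem IsHalfSaturating.two_mul_le {m : ℕ} [NeZero m] {A : Finset (ZMod m)} (hm : Odd m)
    (hA : IsHalfSaturating (A : Set (ZMod m))) : 2 * m ≤ (A.card + 1) * A.card := by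
  have hG : Odd (Nat.card (ZMod m)) := by rwa [Nat.card_zmod]
  have hsub : (Finset.univ : Finset (ZMod m)) ⊆ A.sym2.image
      (Sym2.lift ⟨fun a b ↦ half a + half b, fun a b ↦ add_comm _ _⟩) := by
    intro x _
    rw [Finset.mem_image]
    by_cases hx : x ∈ A
    · exact ⟨s(x, x), by simpa using hx, (add_self_eq_iff_eq_half hG _ _).2 rfl⟩
    · obtain ⟨a, ha, b, hb, -, rfl⟩ := hA x (by simpa using hx)
      exact ⟨s(a, b), by simpa using ⟨ha, hb⟩, rfl⟩
  have h := (Finset.card_le_card hsub).trans Finset.card_image_le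
  rw [Finset.card_univ, ZMod.card, Finset.card_sym2, Nat.choose_two_right,
    Nat.le_div_iff_mul_le two_pos] at h
  simpa [mul_comm] using h

/-! ### Sets of integers and their residues -/

/-- The residues modulo `m` of a finite set of integers. -/
def residues (m : ℕ) (S : Finset ℤ) : Set (ZMod m) := (fun z : ℤ ↦ (z : ZMod m)) '' S

theorem encard_residues_le (m : ℕ) {S : Finset ℤ} {N : ℕ} (h : S.card ≤ N) :
    (residues m S).encard ≤ N := by
  refine (Set.encard_image_le _ _).trans ?_
  rw [Set.encard_coe_eq_coe_finsetCard]
  exact_mod_cast h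

/-- Any `m` consecutive integers represent all residues modulo `m`. -/
theorem exists_intCast_eq {m : ℕ} (hm : 0 < m) (l : ℤ) (x : ZMod m) :
    ∃ z : ℤ, l ≤ z ∧ z < l + m ∧ (z : ZMod m) = x := by
  obtain ⟨y, rfl⟩ := ZMod.intCast_surjective x
  have hm' : (0 : ℤ) < m := by exact_mod_cast hm
  refine ⟨l + (y - l) % m, ?_, ?_, ?_⟩
  · have := Int.emod_nonneg (y - l) hm'.ne'
    omega
  · have := Int.emod_lt_of_pos (y - l) hm'
    omega
  · push_cast [ZMod.intCast_mod]
    ring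

/-- `S` is a `(2, -1)`-cover of length `M`: the differences `2a - b` with `a, b ∈ S` include `M`
consecutive integers. -/
def CoversInterval (S : Finset ℤ) (M : ℤ) : Prop :=
  ∃ l : ℤ, ∀ z, l ≤ z → z < l + M → ∃ a ∈ S, ∃ b ∈ S, z = 2 * a - b

theorem CoversInterval.isSaturating {S : Finset ℤ} {M : ℤ} (h : CoversInterval S M) {m : ℕ}
    (hm : 0 < m) (hM : (m : ℤ) ≤ M) : IsSaturating {(2, -1)} (residues m S) := by
  obtain ⟨l, hl⟩ := h
  intro x hx
  obtain ⟨z, hz1, hz2, rfl⟩ := exists_intCast_eq hm l x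
  obtain ⟨a, ha, b, hb, rfl⟩ := hl z hz1 (by omega)
  refine ⟨_, rfl, a, ⟨a, ha, rfl⟩, b, ⟨b, hb, rfl⟩, ?_, by simp [sub_eq_add_neg]⟩
  intro hab
  refine hx ⟨a, ha, ?_⟩
  push_cast
  rw [← show (a : ZMod m) = b from hab]
  ring

/-- The set `4S + {0, 1}`: appends a lowest base-`4` digit `0` or `1` to the elements of `S`. -/
def appendDigit (S : Finset ℤ) : Finset ℤ :=
  S.image (fun x ↦ 4 * x) ∪ S.image (fun x ↦ 4 * x + 1)

theorem mem_appendDigit {S : Finset ℤ} {z : ℤ} :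
    z ∈ appendDigit S ↔ ∃ x ∈ S, z = 4 * x ∨ z = 4 * x + 1 := by
  simp only [appendDigit, Finset.mem_union, Finset.mem_image]
  grind

theorem card_appendDigit_iterate_le (S : Finset ℤ) (n : ℕ) :
    (appendDigit^[n] S).card ≤ S.card * 2 ^ n := by
  induction n with
  | zero => simp
  | succ n ih =>
    rw [Function.iterate_succ_apply', pow_succ]
    refine (Finset.card_union_le _ _).trans ?_
    have h1 := Finset.card_image_le (s := appendDigit^[n] S) (f := fun x ↦ 4 * x)
    have h2 := Finset.card_image_le (s := appendDigit^[n] S) (f := fun x ↦ 4 * x + 1)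
    linarith

/-- With digits `e, f ∈ {0, 1}` the digit `2e - f` runs through `-1, 0, 1, 2`, a complete residue
system modulo `4`; so each further digit multiplies the length of a cover by `4`. -/
theorem CoversInterval.appendDigit_iterate {S : Finset ℤ} {M : ℤ} (h : CoversInterval S M)
    (n : ℕ) : CoversInterval (appendDigit^[n] S) (M * 4 ^ n) := by
  induction n with
  | zero => simpa using h
  | succ n ih =>
    obtain ⟨l, hl⟩ := ih
    rw [Function.iterate_succ_apply', pow_succ, ← mul_assoc]
    refine ⟨4 * l - 1, fun z h1 h2 ↦ ?_⟩
    obtain ⟨a, ha, b, hb, hab⟩ := hl ((z + 1) / 4) (by omega) (by omega)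
    have key : ∀ e f : ℤ, (e = 0 ∨ e = 1) → (f = 0 ∨ f = 1) → z = 4 * (2 * a - b) + (2 * e - f) →
        ∃ a ∈ appendDigit (appendDigit^[n] S), ∃ b ∈ appendDigit (appendDigit^[n] S),
          z = 2 * a - b := by
      intro e f he hf hz
      refine ⟨4 * a + e, mem_appendDigit.2 ⟨a, ha, by omega⟩,
        4 * b + f, mem_appendDigit.2 ⟨b, hb, by omega⟩, by omega⟩
    have : (z + 1) % 4 = 0 ∨ (z + 1) % 4 = 1 ∨ (z + 1) % 4 = 2 ∨ (z + 1) % 4 = 3 := by omega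
    rcases this with h | h | h | h
    · exact key 0 1 (by omega) (by omega) (by omega)
    · exact key 0 0 (by omega) (by omega) (by omega)
    · exact key 1 1 (by omega) (by omega) (by omega)
    · exact key 1 0 (by omega) (by omega) (by omega)

theorem coversInterval_zero : CoversInterval {0} 1 :=
  ⟨0, fun z h1 h2 ↦ ⟨0, by simp, 0, by simp, by omega⟩⟩

theorem coversInterval_zero_one_two : CoversInterval {0, 1, 2} 7 := by
  refine ⟨-2, fun z h1 h2 ↦ ?_⟩
  have h1' : -2 ≤ z := h1
  have h2' : z < 5 := by omega
  interval_cases z <;> decide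

/-! ### Base-4 digit sets have no three-term progressions -/

/-- The elements of `{0, 1}`-digit sets are at most `(4 ^ n - 1) / 3`. -/
theorem mem_appendDigit_iterate_bounds (n : ℕ) :
    ∀ z ∈ appendDigit^[n] {0}, 0 ≤ z ∧ 3 * z ≤ 4 ^ n - 1 := by
  induction n with
  | zero => simp
  | succ n ih =>
    intro z hz
    rw [Function.iterate_succ_apply', mem_appendDigit] at hz
    obtain ⟨x, hx, hz⟩ := hz
    have := ih x hx
    rw [pow_succ]
    omega

/-- Digits `0, 1` admit no carries in `a + b = 2c`, which therefore holds digit by digit. -/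
theorem eq_of_add_eq_two_mul_of_mem_appendDigit_iterate (n : ℕ) :
    ∀ a ∈ appendDigit^[n] {0}, ∀ b ∈ appendDigit^[n] {0}, ∀ c ∈ appendDigit^[n] {0},
      a + b = 2 * c → a = b := by
  induction n with
  | zero => simp
  | succ n ih =>
    intro a ha b hb c hc h
    rw [Function.iterate_succ_apply', mem_appendDigit] at ha hb hc
    obtain ⟨x, hx, ha⟩ := ha
    obtain ⟨y, hy, hb⟩ := hb
    obtain ⟨z, hz, hc⟩ := hc
    have := ih x hx y hy z hz (by omega)
    omega

theorem isAvoiding_residues {n m : ℕ} (hm : 2 * (4 ^ n - 1) < 3 * (m : ℤ)) :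
    IsAvoiding {(2, -1)} (residues m (appendDigit^[n] {0})) := by
  rintro ⟨_, rfl, _, ⟨a, ha, rfl⟩, _, ⟨c, hc, rfl⟩, _, ⟨b, hb, rfl⟩, -, hab, -, h⟩
  have ha' := mem_appendDigit_iterate_bounds n a ha
  have hb' := mem_appendDigit_iterate_bounds n b hb
  have hc' := mem_appendDigit_iterate_bounds n c hc
  have hdvd : (m : ℤ) ∣ a + b - 2 * c := by
    rw [← ZMod.intCast_zmod_eq_zero_iff_dvd]
    push_cast
    rw [show (a : ZMod m) = (2 : ℤ) • (c : ZMod m) + (-1 : ℤ) • (b : ZMod m) from h]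
    simp
  have h0 := Int.eq_zero_of_abs_lt_dvd hdvd (abs_lt.2 ⟨by omega, by omega⟩)
  exact hab (congrArg _ (eq_of_add_eq_two_mul_of_mem_appendDigit_iterate n a ha b hb c hc
    (by omega)))

/-! ### The cyclic groups of odd order: coefficients `(2, -1)` -/

theorem exists_sat_eq {m : ℕ} (hm : 0 < m) :
    ∃ s : ℕ, sat {(2, -1)} (ZMod m) = s ∧ (s : ℝ) < √(3 * m) := by
  suffices ∃ (S : Finset ℤ) (M : ℤ), CoversInterval S M ∧ (m : ℤ) ≤ M ∧ S.card ^ 2 < 3 * m by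
    obtain ⟨S, M, hS, hM, hc⟩ := this
    obtain ⟨s, hs, hs', -⟩ := exists_iInf_encard_eq_natCast (hS.isSaturating hm hM)
      (encard_residues_le m le_rfl)
    refine ⟨s, hs, Real.lt_sqrt_of_sq_lt ?_⟩
    exact_mod_cast (Nat.pow_le_pow_left hs' 2).trans_lt hc
  have hex : ∃ n, m ≤ 4 ^ n := ⟨m, (Nat.lt_pow_self (by norm_num)).le⟩
  obtain ⟨n, hn, hmin⟩ : ∃ n, m ≤ 4 ^ n ∧ ∀ k < n, 4 ^ k < m :=
    ⟨Nat.find hex, Nat.find_spec hex, fun k hk ↦ not_le.1 (Nat.find_min hex hk)⟩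
  by_cases h3 : 4 ^ n < 3 * m
  · refine ⟨_, _, coversInterval_zero.appendDigit_iterate n, by rw [one_mul]; exact_mod_cast hn, ?_⟩
    refine (Nat.pow_le_pow_left (card_appendDigit_iterate_le _ n) 2).trans_lt ?_
    rwa [Finset.card_singleton, one_mul, ← pow_mul, mul_comm, pow_mul]
  · -- Here `4 ^ (k + 1) < m ≤ (4 / 3) * 4 ^ (k + 1)`, and the leading digits `{0, 1, 2}` suffice.
    obtain ⟨k, rfl⟩ : ∃ k, n = k + 2 := by
      rcases n with _ | _ | k
      · omega
      · have := hmin 0 one_pos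
        omega
      · exact ⟨k, rfl⟩
    have hk := hmin (k + 1) (by omega)
    have e1 : 4 ^ (k + 1) = 4 ^ k * 4 := pow_succ _ _
    have e2 : 4 ^ (k + 2) = 4 ^ k * 4 * 4 := by ring
    refine ⟨_, _, coversInterval_zero_one_two.appendDigit_iterate k, ?_, ?_⟩
    · have : m ≤ 7 * 4 ^ k := by omega
      exact_mod_cast this
    refine (Nat.pow_le_pow_left (card_appendDigit_iterate_le _ k) 2).trans_lt ?_
    rw [mul_pow, ← pow_mul, mul_comm k, pow_mul, show ({0, 1, 2} : Finset ℤ).card = 3 from rfl]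
    norm_num
    omega

theorem exists_minComplete_eq {m n : ℕ} (h1 : (2 / 3 : ℝ) * (4 ^ n - 1) < m)
    (h2 : (m : ℝ) < 4 ^ n) :
    ∃ s : ℕ, minComplete {(2, -1)} (ZMod m) = s ∧ (s : ℝ) < √(1.5 * m) := by
  have h1' : 2 * (4 ^ n - 1) < 3 * (m : ℤ) := by
    have : (2 : ℝ) * (4 ^ n - 1) < 3 * m := by linarith
    exact_mod_cast this
  have h2' : m < 4 ^ n := by exact_mod_cast h2
  have hm : 0 < m := by
    have := h2'.trans_le' (Nat.zero_le _)
    zify at this ⊢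
    omega
  -- Both sides of `2 * (4 ^ n - 1) < 3 * m` are multiples of `3`, so they differ by at least `3`.
  have h4 : (4 : ℤ) ^ n % 3 = 1 := by
    have : (4 : ℤ) ^ n ≡ 1 ^ n [ZMOD 3] := Int.ModEq.pow n rfl
    simpa [Int.ModEq] using this
  have h5 : 2 * (4 : ℤ) ^ n < 3 * m := by omega
  obtain ⟨s, hs, hs', -⟩ := exists_iInf_encard_eq_natCast (P := IsCompleteAvoiding {(2, -1)})
    ⟨isAvoiding_residues h1', (coversInterval_zero.appendDigit_iterate n).isSaturating hm
      (by rw [one_mul]; exact_mod_cast h2'.le)⟩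
    (encard_residues_le m (card_appendDigit_iterate_le {0} n))
  refine ⟨s, hs, Real.lt_sqrt_of_sq_lt ?_⟩
  rw [Finset.card_singleton, one_mul] at hs'
  have h6 : s ^ 2 ≤ 4 ^ n := (Nat.pow_le_pow_left hs' 2).trans_eq (by
    rw [← pow_mul, mul_comm, pow_mul]; norm_num)
  have h6' : (s : ℝ) ^ 2 ≤ 4 ^ n := by exact_mod_cast h6
  have h5' : 2 * (4 : ℝ) ^ n < 3 * m := by exact_mod_cast h5
  linarith

/-! ### Mrose's additive basis and the coefficients `(1/2, 1/2)` -/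

/-- The arithmetic progression `b, b + d, …, b + (k - 1) d`. -/
def arithProg (b d : ℤ) (k : ℕ) : Finset ℤ := (Finset.range k).image fun i : ℕ ↦ b + i * d

theorem mem_arithProg {b d : ℤ} {k : ℕ} {i : ℤ} (h0 : 0 ≤ i) (h1 : i < k) :
    b + i * d ∈ arithProg b d k := by
  lift i to ℕ using h0
  exact Finset.mem_image.2 ⟨i, by simpa using h1, rfl⟩

theorem card_arithProg_le (b d : ℤ) (k : ℕ) : (arithProg b d k).card ≤ k :=
  Finset.card_image_le.trans (by simp)

/-- Mrose's additive basis: `7t + 3` integers, whose pairwise sums include every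
integer in `[0, 14t² + 10t)`. -/
def mroseBasis (t : ℕ) : Finset ℤ :=
  arithProg 0 1 (t + 1) ∪ arithProg (2 * t) t (3 * t) ∪ arithProg (3 * t ^ 2 + 2 * t) (t + 1) t ∪
    arithProg (6 * t ^ 2 + 4 * t) 1 (t + 1) ∪ arithProg (10 * t ^ 2 + 7 * t) 1 (t + 1)

theorem card_mroseBasis_le (t : ℕ) : (mroseBasis t).card ≤ 7 * t + 3 := by
  refine (Finset.card_union_le _ _).trans ?_
  refine (add_le_add_left (Finset.card_union_le _ _) _).trans ?_
  refine (add_le_add_left (add_le_add_left (Finset.card_union_le _ _) _) _).trans ?_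
  refine (add_le_add_left (add_le_add_left (add_le_add_left
    (Finset.card_union_le _ _) _) _) _).trans ?_
  have := card_arithProg_le 0 1 (t + 1)
  have := card_arithProg_le (2 * t) t (3 * t)
  have := card_arithProg_le (3 * t ^ 2 + 2 * t) (t + 1) t
  have := card_arithProg_le (6 * t ^ 2 + 4 * t) 1 (t + 1)
  have := card_arithProg_le (10 * t ^ 2 + 7 * t) 1 (t + 1)
  omega

/-- A progression with `k` terms and difference `d`, added to `n ≥ d` consecutive integers, fills
an interval of length `(k - 1) * d + n`. -/
theorem exists_add_eq_of_mem_interval {b c d z : ℤ} {k n : ℕ} (hd : 0 < d) (hk : 0 < k)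
    (hn : d ≤ n) (h0 : b + c ≤ z) (h1 : z < b + c + (k - 1) * d + n) :
    ∃ x ∈ arithProg b d k, ∃ y ∈ arithProg c 1 n, z = x + y := by
  rcases lt_or_ge z (b + c + k * d) with h | h
  · have e := Int.emod_add_mul_ediv (z - b - c) d
    have e0 := Int.emod_nonneg (z - b - c) hd.ne'
    have e1 := Int.emod_lt_of_pos (z - b - c) hd
    exact ⟨b + (z - b - c) / d * d, mem_arithProg (Int.ediv_nonneg (by omega) hd.le)
      (Int.ediv_lt_of_lt_mul hd (by omega)), c + (z - b - c) % d * 1,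
      mem_arithProg e0 (by omega), by linarith⟩
  · exact ⟨b + (k - 1) * d, mem_arithProg (by omega) (by omega),
      c + (z - b - c - (k - 1) * d) * 1, mem_arithProg (by linarith) (by linarith), by ring⟩

theorem exists_add_eq_of_mroseBasis {t : ℕ} (ht : 0 < t) {z : ℤ} (h0 : 0 ≤ z)
    (h1 : z < 14 * t ^ 2 + 10 * t) : ∃ x ∈ mroseBasis t, ∃ y ∈ mroseBasis t, z = x + y := by
  have ht' : (0 : ℤ) < t := by exact_mod_cast ht
  have m1 : arithProg 0 1 (t + 1) ⊆ mroseBasis t := by intro x; simp +contextual [mroseBasis]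
  have m2 : arithProg (2 * t) t (3 * t) ⊆ mroseBasis t := by
    intro x; simp +contextual [mroseBasis]
  have m3 : arithProg (3 * t ^ 2 + 2 * t) (t + 1) t ⊆ mroseBasis t := by
    intro x; simp +contextual [mroseBasis]
  have m4 : arithProg (6 * t ^ 2 + 4 * t) 1 (t + 1) ⊆ mroseBasis t := by
    intro x; simp +contextual [mroseBasis]
  have m5 : arithProg (10 * t ^ 2 + 7 * t) 1 (t + 1) ⊆ mroseBasis t := by
    intro x; simp +contextual [mroseBasis]
  -- A progression of difference `d` plus one of the three intervals of length `t + 1 ≥ d`.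
  have key : ∀ {b c d : ℤ} {k : ℕ}, arithProg b d k ⊆ mroseBasis t →
      arithProg c 1 (t + 1) ⊆ mroseBasis t → 0 < d → d ≤ t + 1 → 0 < k →
      b + c ≤ z → z < b + c + (k - 1) * d + (t + 1) →
      ∃ x ∈ mroseBasis t, ∃ y ∈ mroseBasis t, z = x + y := by
    intro b c d k hb hc hd hd' hk hz hz'
    obtain ⟨x, hx, y, hy, h⟩ := exists_add_eq_of_mem_interval (n := t + 1) hd hk
      (by exact_mod_cast hd') hz (by exact_mod_cast hz')
    exact ⟨x, hb hx, y, hc hy, h⟩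
  rcases lt_or_ge z (2 * t + 1) with h | h
  · refine key m1 m1 one_pos (by omega) (by omega) (by omega) ?_
    push_cast
    linarith
  rcases lt_or_ge z (3 * t ^ 2 + 2 * t + 1) with h | h
  · refine key m2 m1 ht' (by omega) (by omega) (by omega) ?_
    push_cast
    linarith
  rcases lt_or_ge z (4 * t ^ 2 + 3 * t) with h | h
  · refine key m3 m1 (by omega) le_rfl ht (by omega) ?_
    linarith
  rcases lt_or_ge z (6 * t ^ 2 + 4 * t) with h | h
  · -- The differences `t` and `t + 1`: with `z - (3t² + 2t) = qt + r`, `0 ≤ r < t`,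
    -- use `qt + r = (q - r)t + r(t + 1)`.
    obtain ⟨w, hw⟩ : ∃ w, w = z - (3 * t ^ 2 + 2 * t) := ⟨_, rfl⟩
    have e := Int.emod_add_mul_ediv w t
    have e0 := Int.emod_nonneg w ht'.ne'
    have e1 := Int.emod_lt_of_pos w ht'
    have q0 : (t + 1 : ℤ) ≤ w / t := (Int.le_ediv_iff_mul_le ht').2 (by linarith)
    have q1 : w / t < 3 * t + 2 := Int.ediv_lt_of_lt_mul ht' (by linarith)
    refine ⟨2 * t + (w / t - w % t - 2) * t, m2 (mem_arithProg (by omega) (by push_cast; omega)),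
      3 * t ^ 2 + 2 * t + w % t * (t + 1), m3 (mem_arithProg e0 e1), ?_⟩
    linarith
  rcases lt_or_ge z (6 * t ^ 2 + 6 * t + 1) with h | h
  · refine key m1 m4 one_pos (by omega) (by omega) (by omega) ?_
    push_cast
    linarith
  rcases lt_or_ge z (9 * t ^ 2 + 6 * t + 1) with h | h
  · refine key m2 m4 ht' (by omega) (by omega) (by omega) ?_
    push_cast
    linarith
  rcases lt_or_ge z (10 * t ^ 2 + 7 * t) with h | h
  · refine key m3 m4 (by omega) le_rfl ht (by omega) ?_
    linarith
  rcases lt_or_ge z (10 * t ^ 2 + 9 * t + 1) with h | h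
  · refine key m1 m5 one_pos (by omega) (by omega) (by omega) ?_
    push_cast
    linarith
  rcases lt_or_ge z (13 * t ^ 2 + 9 * t + 1) with h | h
  · refine key m2 m5 ht' (by omega) (by omega) (by omega) ?_
    push_cast
    linarith
  · refine key m3 m5 (by omega) le_rfl ht (by omega) ?_
    linarith

theorem isHalfSaturating_residues {m : ℕ} (hm : Odd m) {S : Finset ℤ}
    (hS : ∀ z : ℤ, 0 ≤ z → z < m → ∃ x ∈ S, ∃ y ∈ S, z = x + y) :
    IsHalfSaturating (residues m S) := by
  have hG : Odd (Nat.card (ZMod m)) := by rwa [Nat.card_zmod]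
  intro x hx
  obtain ⟨z, hz1, hz2, hz⟩ := exists_intCast_eq hm.pos 0 (x + x)
  obtain ⟨a, ha, b, hb, rfl⟩ := hS z hz1 (by omega)
  have hxab : x = half (a : ZMod m) + half (b : ZMod m) := by
    have h1 := (add_self_eq_iff_eq_half hG (half (a : ZMod m)) a).2 rfl
    have h2 := (add_self_eq_iff_eq_half hG (half (b : ZMod m)) b).2 rfl
    rw [(add_self_eq_iff_eq_half hG x _).1 rfl, eq_comm, ← add_self_eq_iff_eq_half hG, ← hz]
    push_cast
    nth_rw 3 [← h1]
    nth_rw 3 [← h2]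
    abel
  refine ⟨a, ⟨a, ha, rfl⟩, b, ⟨b, hb, rfl⟩, fun hab ↦ hx ⟨a, ha, ?_⟩, hxab⟩
  rw [hxab, ← hab]
  exact ((add_self_eq_iff_eq_half hG _ _).2 rfl).symm

theorem exists_satHalf_eq {m : ℕ} (hm : Odd m) :
    ∃ s : ℕ, satHalf (ZMod m) = s ∧
      √(2 * m) - 0.5 < (s : ℝ) ∧ (s : ℝ) ≤ √3.5 * √m + 10 := by
  have : NeZero m := ⟨hm.pos.ne'⟩
  have hm0 : (0 : ℝ) < m := by exact_mod_cast hm.pos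
  obtain ⟨t, ht⟩ : ∃ t, t = ⌈√(m / 14 : ℝ)⌉₊ := ⟨_, rfl⟩
  have ht0 : 0 < t := ht ▸ Nat.ceil_pos.2 (by positivity)
  have ht1 : √(m / 14 : ℝ) ≤ t := ht ▸ Nat.le_ceil _
  have ht2 : t < √(m / 14 : ℝ) + 1 := ht ▸ Nat.ceil_lt_add_one (Real.sqrt_nonneg _)
  have hmt : (m : ℤ) ≤ 14 * t ^ 2 + 10 * t := by
    have h := (Real.sqrt_le_left (by positivity)).1 ht1
    have h' : (m : ℝ) ≤ 14 * t ^ 2 + 10 * t := by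
      have : (0 : ℝ) ≤ t := by positivity
      linarith
    exact_mod_cast h'
  obtain ⟨s, hs, hs', B, hB, hBs⟩ := exists_iInf_encard_eq_natCast
    (isHalfSaturating_residues hm (S := mroseBasis t) fun z h0 h1 ↦
      exists_add_eq_of_mroseBasis ht0 h0 (h1.trans_le hmt))
    (encard_residues_le m (card_mroseBasis_le t))
  refine ⟨s, hs, ?_, ?_⟩
  · obtain ⟨B, rfl⟩ := B.toFinite.exists_finset_coe
    have h := hB.two_mul_le hm
    rw [Set.encard_coe_eq_coe_finsetCard] at hBs
    rw [show B.card = s by exact_mod_cast hBs] at h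
    have h' : 2 * (m : ℝ) ≤ (s + 1) * s := by exact_mod_cast h
    rw [sub_lt_iff_lt_add, Real.sqrt_lt' (by positivity)]
    nlinarith
  · have h7 : √3.5 * √m = 7 * √(m / 14 : ℝ) := by
      rw [← Real.sqrt_mul (by norm_num), show (3.5 * m : ℝ) = 7 ^ 2 * (m / 14) by ring,
        Real.sqrt_mul (by norm_num), Real.sqrt_sq (by norm_num)]
    have : (s : ℝ) ≤ 7 * t + 3 := by exact_mod_cast hs'
    linarith
/-! ### Difference sets fixed by doubling -/

/-- A Sidon set contains no three-term progression; if it is fixed by doubling and its differences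
`d - d'` are all nonzero elements, these are also the values `2a - d'`. -/
theorem isCompleteAvoiding_of_sidon {G : Type*} [AddCommGroup G] {D : Set G}
    (hne : D.Nonempty)
    (hdiff : ∀ x ≠ 0, ∃ a ∈ D, ∃ b ∈ D, x = a - b)
    (hsidon : ∀ a ∈ D, ∀ b ∈ D, ∀ c ∈ D, ∀ d ∈ D, a ≠ b → a - b = c - d → a = c)
    (hdouble : ∀ a ∈ D, a + a ∈ D) (hhalve : ∀ a ∈ D, ∃ b ∈ D, b + b = a) :
    IsCompleteAvoiding {(2, -1)} D := by
  constructor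
  · rintro ⟨_, rfl, a, ha, b, hb, c, hc, hab, -, -, h⟩
    have h' : a = b + b - c := by rw [h]; simp only; module
    exact hab (hsidon a ha b hb b hb c hc hab (by rw [h']; abel))
  · intro x hx
    by_cases hx0 : x = 0
    · subst hx0
      obtain ⟨a, ha⟩ := hne
      refine ⟨_, rfl, a, ha, a + a, hdouble a ha, fun h ↦ hx ?_, by simp only; module⟩
      rwa [left_eq_add.1 h] at ha
    · obtain ⟨a, ha, b, hb, rfl⟩ := hdiff x hx0
      obtain ⟨a, ha', rfl⟩ := hhalve a ha
      refine ⟨_, rfl, a, ha', b, hb, fun h ↦ hx ?_, by simp only; module⟩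
      rwa [h, add_sub_cancel_right]

/-- The nonzero differences of a Sidon set are distinct. -/
theorem card_sq_le_of_sidon {G : Type*} [AddCommGroup G] [Fintype G] [DecidableEq G] {D : Finset G}
    (hsidon : ∀ a ∈ D, ∀ b ∈ D, ∀ c ∈ D, ∀ d ∈ D, a ≠ b → a - b = c - d → a = c) :
    D.card * D.card - D.card ≤ Fintype.card G - 1 := by
  rw [← Finset.offDiag_card, ← Finset.card_univ, ← Finset.card_erase_of_mem (Finset.mem_univ 0)]
  refine Finset.card_le_card_of_injOn (fun p ↦ p.1 - p.2) ?_ ?_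
  · intro p hp
    have hp' : p.1 ∈ D ∧ p.2 ∈ D ∧ p.1 ≠ p.2 := by simpa using hp
    simpa [sub_eq_zero] using hp'.2.2
  · intro p hp r hr h
    have hp' : p.1 ∈ D ∧ p.2 ∈ D ∧ p.1 ≠ p.2 := by simpa using hp
    have hr' : r.1 ∈ D ∧ r.2 ∈ D ∧ r.1 ≠ r.2 := by simpa using hr
    have h' : p.1 - p.2 = r.1 - r.2 := h
    have h1 := hsidon _ hp'.1 _ hp'.2.1 _ hr'.1 _ hr'.2.1 hp'.2.2 h'
    rw [h1] at h'
    exact Prod.ext h1 (sub_right_injective h')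

/-! ### Planes in cubic extensions -/

section Cubic

open Module

variable {K F : Type*} [Field K] [Field F] [Algebra K F]

/-- Any two planes `ker f` and `u⁻¹ • ker f` of a cubic extension meet in a nonzero vector. -/
theorem exists_mem_ker_mul_mem_ker (h3 : finrank K F = 3) (f : F →ₗ[K] K) (u : F) :
    ∃ y ≠ 0, f y = 0 ∧ f (u * y) = 0 := by
  have : FiniteDimensional K F := .of_finrank_pos (by omega)
  have h : LinearMap.ker (f.prod (f ∘ₗ LinearMap.mulLeft K u)) ≠ ⊥ :=
    LinearMap.ker_ne_bot_of_finrank_lt (by rw [h3, finrank_prod, finrank_self]; norm_num)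
  obtain ⟨y, hy, hy0⟩ := Submodule.exists_mem_ne_zero_of_ne_bot h
  exact ⟨y, hy0, by simpa using hy⟩

/-- For `u ∉ K` the planes `ker f` and `u⁻¹ • ker f` meet in a line only: a plane is not stable
under `u`, since the elements stabilizing it form a subalgebra, and a cubic extension has no
intermediate ones. -/
theorem exists_smul_eq_of_mem_ker (h3 : finrank K F = 3) {f : F →ₗ[K] K} (hf : f ≠ 0) {u : F}
    (hu : u ∉ Set.range (algebraMap K F)) {y w : F} (hy0 : y ≠ 0) (hy : f y = 0)
    (huy : f (u * y) = 0) (hw : f w = 0) (huw : f (u * w) = 0) : ∃ c : K, w = c • y := by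
  have : FiniteDimensional K F := .of_finrank_pos (by omega)
  have hker : finrank K (LinearMap.ker f) = 2 := by
    have h := f.finrank_range_add_finrank_ker
    rw [LinearMap.range_eq_top.2 (LinearMap.surjective hf), finrank_top, finrank_self, h3] at h
    omega
  let P : Submodule K F := LinearMap.ker f ⊓ LinearMap.ker (f ∘ₗ LinearMap.mulLeft K u)
  have hlt : P < LinearMap.ker f := by
    refine lt_of_le_of_ne inf_le_left fun hP ↦ ?_
    let S : Subalgebra K F :=
      { carrier := {v | ∀ x, f x = 0 → f (v * x) = 0}
        mul_mem' := fun {a b} ha hb x hx ↦ by rw [mul_assoc]; exact ha _ (hb x hx)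
        add_mem' := fun {a b} ha hb x hx ↦ by rw [add_mul, map_add, ha x hx, hb x hx, add_zero]
        algebraMap_mem' := fun r x hx ↦ by rw [← Algebra.smul_def, map_smul, hx, smul_zero] }
    have huS : u ∈ S := fun x hx ↦ by
      have hxP : x ∈ P := hP ▸ LinearMap.mem_ker.2 hx
      simpa using hxP.2
    have hsimple := Subalgebra.isSimpleOrder_of_finrank_prime K F (h3 ▸ Nat.prime_three)
    rcases hsimple.eq_bot_or_eq_top S with hS | hS
    · rw [hS] at huS
      exact hu (Algebra.mem_bot.1 huS)
    · refine hf (LinearMap.ext fun x ↦ ?_)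
      have hxS : x * y⁻¹ ∈ S := hS ▸ Algebra.mem_top
      simpa [hy0] using hxS y hy
  have hP1 : finrank K P ≤ 1 := by
    have := Submodule.finrank_lt_finrank_of_lt hlt
    omega
  obtain ⟨v, hv⟩ := finrank_le_one_iff.1 hP1
  obtain ⟨a, ha⟩ := hv ⟨y, hy, huy⟩
  obtain ⟨b, hb⟩ := hv ⟨w, hw, huw⟩
  have ha' : a • (v : F) = y := congrArg Subtype.val ha
  have hb' : b • (v : F) = w := congrArg Subtype.val hb
  have ha0 : a ≠ 0 := by
    rintro rfl
    exact hy0 (by rw [← ha', zero_smul])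
  exact ⟨b / a, by rw [← hb', ← ha', smul_smul, div_mul_cancel₀ _ ha0]⟩

end Cubic

/-! ### Singer difference sets in characteristic two -/

/-- In characteristic two the trace of a finite field extension commutes with squaring. -/
theorem trace_mul_self {K F : Type*} [Field K] [Field F] [Finite F] [Algebra K F] [CharP F 2]
    (x : F) : Algebra.trace K F (x * x) = Algebra.trace K F x * Algebra.trace K F x := by
  apply FaithfulSMul.algebraMap_injective K F
  rw [map_mul (algebraMap K F), FiniteField.algebraMap_trace_eq_sum_pow, FiniteField.algebraMap_trace_eq_sum_pow,
    ← sq, ← sq, sum_pow_char 2]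
  exact Finset.sum_congr rfl fun i _ ↦ by rw [← pow_mul, ← pow_mul, mul_comm]

/-- For a cubic extension `F / K` of finite fields with `q = #K`, the cyclic group `Fˣ / Kˣ` is
`ZMod (q² + q + 1)`, written additively. -/
theorem exists_monoidHom_zmod {K F : Type*} [Field K] [Field F] [Finite F] [Algebra K F]
    (h3 : Module.finrank K F = 3) {m : ℕ} (hm : m = Nat.card K ^ 2 + Nat.card K + 1) :
    ∃ φ : Fˣ →* Multiplicative (ZMod m), Function.Surjective φ ∧
      ∀ x, φ x = 1 ↔ (x : F) ∈ Set.range (algebraMap K F) := by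
  have hfin : Finite K := Finite.of_injective _ (FaithfulSMul.algebraMap_injective K F)
  let N : Subgroup Fˣ := (Units.map (algebraMap K F : K →* F)).range
  have hN : Nat.card N = Nat.card K - 1 := by
    rw [← Nat.card_units]
    exact (Nat.card_congr (MonoidHom.ofInjective
      (Units.map_injective (FaithfulSMul.algebraMap_injective K F))).toEquiv).symm
  have hcard : Nat.card (Fˣ ⧸ N) = m := by
    have h := N.card_eq_card_quotient_mul_card_subgroup
    rw [hN, Nat.card_units, Module.natCard_eq_pow_finrank (K := K), h3] at h
    have hq : 1 < Nat.card K := Finite.one_lt_card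
    obtain ⟨r, hr⟩ : ∃ r, Nat.card K = r + 2 := ⟨Nat.card K - 2, by omega⟩
    rw [hr] at h hm
    refine Nat.eq_of_mul_eq_mul_right (show 0 < r + 2 - 1 by omega) (h.symm.trans ?_)
    rw [hm, Nat.sub_eq_iff_eq_add (Nat.one_le_pow _ _ (by omega)), show r + 2 - 1 = r + 1 by omega]
    ring
  have hcyc : IsCyclic (Fˣ ⧸ N) :=
    isCyclic_of_surjective (QuotientGroup.mk' N) (QuotientGroup.mk'_surjective N)
  subst hcard
  refine ⟨(zmodCyclicMulEquiv hcyc).symm.toMonoidHom.comp (QuotientGroup.mk' N),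
    (zmodCyclicMulEquiv hcyc).symm.surjective.comp (QuotientGroup.mk'_surjective N), fun x ↦ ?_⟩
  have : (zmodCyclicMulEquiv hcyc).symm (QuotientGroup.mk' N x) = 1 ↔ x ∈ N := by
    rw [map_eq_one_iff _ (zmodCyclicMulEquiv hcyc).symm.injective, QuotientGroup.mk'_apply,
      QuotientGroup.eq_one_iff]
  refine this.trans ⟨?_, ?_⟩
  · rintro ⟨c, rfl⟩
    exact ⟨c, rfl⟩
  · rintro ⟨c, hc⟩
    have hc0 : c ≠ 0 := by
      rintro rfl
      exact x.ne_zero (by rw [← hc, map_zero])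
    exact ⟨Units.mk0 c hc0, Units.ext hc⟩

/-- The Singer difference set of a plane of order `2 ^ t`: the trace-zero elements of the cubic
extension of `GF(2 ^ t)`, modulo scalars. It is fixed by doubling because squaring preserves the
kernel of the trace. -/
theorem exists_singer_set {t m : ℕ} (ht : 0 < t) (hm : m = 2 ^ (2 * t) + 2 ^ t + 1) :
    ∃ A : Set (ZMod m), IsCompleteAvoiding {(2, -1)} A ∧ A.encard ≤ (2 ^ t + 1 : ℕ) := by
  let K := GaloisField 2 t
  let F := FiniteField.Extension K 2 3
  have hK : Nat.card K = 2 ^ t := GaloisField.card 2 t ht.ne'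
  have h3 : Module.finrank K F = 3 := FiniteField.finrank_extension K 2 3
  have hchar : CharP F 2 := charP_of_injective_algebraMap (algebraMap K F).injective 2
  obtain ⟨φ, hφ, hker⟩ := exists_monoidHom_zmod h3
    (show m = Nat.card K ^ 2 + Nat.card K + 1 by rw [hK, hm, ← pow_mul, mul_comm])
  let T : F →ₗ[K] K := Algebra.trace K F
  have hT : T ≠ 0 := fun h ↦ by
    obtain ⟨x, hx⟩ := Algebra.trace_surjective K F 1
    exact one_ne_zero (hx.symm.trans (LinearMap.congr_fun h x))
  let D : Set (ZMod m) := (fun x ↦ (φ x).toAdd) '' {x | T (x : F) = 0}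
  have hdiff : ∀ x ≠ 0, ∃ a ∈ D, ∃ b ∈ D, x = a - b := by
    intro x _
    obtain ⟨u, hu⟩ := hφ (Multiplicative.ofAdd x)
    obtain ⟨y, hy0, hy, huy⟩ := exists_mem_ker_mul_mem_ker h3 T u
    refine ⟨_, ⟨u * Units.mk0 y hy0, huy, rfl⟩, _, ⟨Units.mk0 y hy0, hy, rfl⟩, ?_⟩
    simp [hu]
  have hsidon : ∀ a ∈ D, ∀ b ∈ D, ∀ c ∈ D, ∀ d ∈ D, a ≠ b → a - b = c - d → a = c := by
    rintro _ ⟨x, hx, rfl⟩ _ ⟨y, hy, rfl⟩ _ ⟨z, hz, rfl⟩ _ ⟨w, hw, rfl⟩ hab h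
    -- Modulo scalars, `u = x / y` equals `z / w`; so `y` and `w` lie in both planes of `u`.
    have hu : ((x / y : Fˣ) : F) ∉ Set.range (algebraMap K F) := fun hu ↦ hab (by
      have := (hker _).2 hu
      rw [map_div, div_eq_one] at this
      simp [this])
    obtain ⟨k, hk⟩ := (hker (x / y / (z / w))).1 (by
      rw [map_div, map_div, map_div, div_eq_one]
      exact h)
    have huy : T (((x / y : Fˣ) : F) * y) = 0 := by
      rw [← Units.val_mul, div_mul_cancel]
      exact hx
    have huw : T (((x / y : Fˣ) : F) * w) = 0 := by
      have : ((x / y : Fˣ) : F) * w = k • (z : F) := by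
        rw [Algebra.smul_def, hk, ← Units.val_mul, ← Units.val_mul, div_div_eq_mul_div,
          mul_div_right_comm, mul_assoc]
        simp
      rw [this, map_smul, show T (z : F) = 0 from hz, smul_zero]
    obtain ⟨c, hc⟩ := exists_smul_eq_of_mem_ker h3 hT hu y.ne_zero hy huy hw huw
    have hwy : φ w = φ y := by
      rw [← div_eq_one, ← map_div]
      refine (hker _).2 ⟨c, ?_⟩
      rw [Units.val_div_eq_div_val, hc, Algebra.smul_def, mul_div_cancel_right₀ _ y.ne_zero]
    simp only [hwy] at h
    exact sub_left_injective h
  have hdouble : ∀ a ∈ D, a + a ∈ D := by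
    rintro _ ⟨x, hx, rfl⟩
    refine ⟨x * x, ?_, by simp⟩
    have hx' : Algebra.trace K F x = 0 := hx
    exact (trace_mul_self (K := K) (x : F)).trans (by rw [hx', zero_mul])
  have hhalve : ∀ a ∈ D, ∃ b ∈ D, b + b = a := by
    rintro _ ⟨x, hx, rfl⟩
    obtain ⟨y, hy⟩ := FiniteField.isSquare_of_char_two (ringChar.eq F 2) (x : F)
    have hy0 : y ≠ 0 := by
      rintro rfl
      exact x.ne_zero (by rw [hy, zero_mul])
    have hxy : x = Units.mk0 y hy0 * Units.mk0 y hy0 := Units.ext hy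
    refine ⟨_, ⟨Units.mk0 y hy0, ?_, rfl⟩, by simp [hxy]⟩
    have hx' : Algebra.trace K F x = 0 := hx
    rw [hy, trace_mul_self] at hx'
    exact mul_self_eq_zero.1 hx'
  have hne : D.Nonempty := by
    obtain ⟨y, hy0, hy, -⟩ := exists_mem_ker_mul_mem_ker h3 T 0
    exact ⟨_, Units.mk0 y hy0, hy, rfl⟩
  refine ⟨D, isCompleteAvoiding_of_sidon hne hdiff hsidon hdouble hhalve, ?_⟩
  have : NeZero m := ⟨hm ▸ Nat.succ_ne_zero _⟩
  obtain ⟨A, hA⟩ := D.toFinite.exists_finset_coe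
  rw [← hA] at hsidon ⊢
  have h := card_sq_le_of_sidon hsidon
  rw [ZMod.card] at h
  rw [Set.encard_coe_eq_coe_finsetCard, Nat.cast_le]
  by_contra! hlt
  have h1 : (2 ^ t + 2) * A.card ≤ A.card * A.card := Nat.mul_le_mul_right _ (by omega)
  have h2 : 2 ^ (2 * t) = 2 ^ t * 2 ^ t := by rw [two_mul, pow_add]
  have h3 : (2 ^ t + 1) * (2 ^ t + 2) ≤ (2 ^ t + 1) * A.card := Nat.mul_le_mul_left _ (by omega)
  have h4 : A.card * A.card ≤ 2 ^ (2 * t) + 2 ^ t + A.card := by omega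
  nlinarith

/-- The size is forced: `√m` lies strictly between `2 ^ t` and `2 ^ t + 1`. -/
theorem minComplete_eq_ceil_sqrt {t m : ℕ} (ht : 0 < t) (hm : m = 2 ^ (2 * t) + 2 ^ t + 1) :
    minComplete {(2, -1)} (ZMod m) = (⌈√(m : ℝ)⌉₊ : ℕ) := by
  have : NeZero m := ⟨hm ▸ Nat.succ_ne_zero _⟩
  obtain ⟨A, hA, hAcard⟩ := exists_singer_set ht hm
  obtain ⟨s, hs, hs', B, hB, hBs⟩ := exists_iInf_encard_eq_natCast hA hAcard
  refine hs.trans (congrArg _ ?_)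
  obtain ⟨B, rfl⟩ := B.toFinite.exists_finset_coe
  have h := hB.2.natCast_le_sq
  rw [Set.encard_coe_eq_coe_finsetCard] at hBs
  rw [show B.card = s by exact_mod_cast hBs] at h
  refine le_antisymm (hs'.trans (Nat.succ_le_of_lt (Nat.lt_ceil.2 ?_))) (Nat.ceil_le.2 ?_)
  · refine Real.lt_sqrt_of_sq_lt ?_
    have : (2 ^ t) ^ 2 < m := by
      rw [hm, ← pow_mul, mul_comm t]
      have := Nat.two_pow_pos t
      omega
    exact_mod_cast this
  · refine (Real.sqrt_le_left (by positivity)).2 ?_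
    exact_mod_cast h

theorem theorem2 :
    (∃ c : ℕ → ℝ, ∀ m : ℕ, Odd m →
      1 ≤ c m ∧ c m ≤ 3 ∧
        ∃ s : ℕ, sat {(2, -1)} (ZMod m) = s ∧ (s : ℝ) < √(c m * m)) ∧
    (∃ c : ℕ → ℝ, ∀ m : ℕ, Odd m →
      (∃ n : ℕ, 0 < n ∧ (2 / 3 : ℝ) * (4 ^ n - 1) < m ∧ (m : ℝ) < 4 ^ n) →
      1 ≤ c m ∧ c m ≤ 1.5 ∧
        ∃ s : ℕ, minComplete {(2, -1)} (ZMod m) = s ∧ (s : ℝ) < √(c m * m)) ∧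
    (∃ ε : ℕ → ℝ, Tendsto ε atTop (𝓝 0) ∧ ∀ m : ℕ, Odd m →
      ∃ s : ℕ, satHalf (ZMod m) = s ∧
        √(2 * m) - 0.5 < (s : ℝ) ∧ (s : ℝ) ≤ (√3.5 + ε m) * √m) ∧
    (∀ t : ℕ, 0 < t → ∀ m : ℕ, m = 2 ^ (2 * t) + 2 ^ t + 1 →
      minComplete {(2, -1)} (ZMod m) = (⌈√(m : ℝ)⌉₊ : ℕ)) := by
  refine ⟨⟨fun _ ↦ 3, fun m hm ↦ ⟨by norm_num, le_rfl, exists_sat_eq hm.pos⟩⟩,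
    ⟨fun _ ↦ 1.5, fun m _ ⟨n, _, h1, h2⟩ ↦
      ⟨by norm_num, le_rfl, exists_minComplete_eq h1 h2⟩⟩,
    ⟨fun m ↦ 10 / √m, ?_, fun m hm ↦ ?_⟩,
    fun t ht m hm ↦ minComplete_eq_ceil_sqrt ht hm⟩
  · exact tendsto_const_nhds.div_atTop
      (Real.tendsto_sqrt_atTop.comp tendsto_natCast_atTop_atTop)
  · obtain ⟨s, hs, h1, h2⟩ := exists_satHalf_eq hm
    have hm0 : 0 < √(m : ℝ) := Real.sqrt_pos.2 (by exact_mod_cast hm.pos)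
    exact ⟨s, hs, h1, by rwa [add_mul, div_mul_cancel₀ _ hm0.ne']⟩
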